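/- Let $\mathcal A$ be a finite alphabet, let $X\subseteq\mathcal A^{\mathbb Z}$ be a sofic shift (that is, the set of label sequences of the bi-infinite paths of some finite directed graph whose edges are labeled by elements of $\mathcal A$), and let $\sigma_X:X\to X$, $\sigma_X(x)_i=x_{i+1}$, be the shift map. Let $\varphi$ be a flip for $(X,\sigma_X)$, that is, a homeomorphism $\varphi:X\to X$ such that $\varphi\sigma_X=\sigma_X^{-1}\varphi$ and $\varphi^2=\mathrm{id}_X$. For $m\ge 1$ and $n\in\mathbb Z$ let $$p_{m,n}=|\{x\in X:\sigma_X^m(x)=\sigma_X^n\varphi(x)=x\}|,$$ and let $$G_{\sigma_X,\varphi}(t)=\sum_{m=1}^\infty\left(p_{2m-1,0}\,t^{2m-1}+\frac{p_{2m,0}+p_{2m,1}}{2}\,t^{2m}\right)$$ be the generating function of $(X,\sigma_X,\varphi)$. Then all the numbers $p_{m,n}$ are finite and $G_{\sigma_X,\varphi}$ is a rational function: there are polynomials $P,Q\in\mathbb Q[t]$ with $Q(0)\ne 0$ such that $Q\,G_{\sigma_X,\varphi}=P$ as formal power series, and for all complex $t$ in some disc around $0$ one has $Q(t)\neq 0$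 and the series converges to $P(t)/Q(t)$. -/

import Mathlib

open SymbolicDynamics.FullShift

namespace FlipSystem

/-- `F` is a flip for the invertible topological dynamical system `(X, T)`:
`F` is a homeomorphism with `F T = T⁻¹ F` and `F² = id`. -/
structure IsFlip {X : Type*} [TopologicalSpace X] (T F : X ≃ₜ X) : Prop where
  comm : ∀ x, F (T x) = T.symm (F x)
  invol : ∀ x, F (F x) = x

/-- The set of the points that are fixed by both `T ^ m` and `T ^ n ∘ F`. -/
def fixedSet {X : Type*} [TopologicalSpace X] (T F : X ≃ₜ X) (m : ℕ) (n : ℤ) : Set X :=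
  {x | (T ^ m) x = x ∧ (T ^ n) (F x) = x}

/-- The number `p_{m,n}(T, F)` of points that are fixed by both `T ^ m` and `T ^ n ∘ F`. -/
noncomputable def fixedCount {X : Type*} [TopologicalSpace X] (T F : X ≃ₜ X) (m : ℕ) (n : ℤ) : ℕ :=
  (fixedSet T F m n).ncard

/-- The generating function of the flip system `(X, T, F)`, as a power series:
its constant coefficient is `0`, its coefficient at an odd `m` is `p_{m,0}(T, F)`, and its
coefficient at an even `m ≥ 2` is `(p_{m,0}(T, F) + p_{m,1}(T, F)) / 2`. -/
noncomputable def generatingFunction {X : Type*} [TopologicalSpace X] (T F : X ≃ₜ X) :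
    PowerSeries ℚ :=
  PowerSeries.mk fun m =>
    if m = 0 then 0
    else if Odd m then (fixedCount T F m 0 : ℚ)
    else ((fixedCount T F m 0 : ℚ) + (fixedCount T F m 1 : ℚ)) / 2

/-- A directed multigraph with vertex set `V` and edge set `E`, every edge of which
carries a label in `A`. -/
structure LabeledGraph (V E A : Type*) where
  source : E → V
  target : E → V
  label : E → A

/-- The set of the label sequences of the bi-infinite paths of a labeled graph. -/
def LabeledGraph.presented {V E A : Type*} (G : LabeledGraph V E A) : Set (ℤ → A) :=
  {x | ∃ e : ℤ → E, (∀ i, G.target (e i) = G.source (e (i + 1))) ∧ ∀ i, x i = G.label (e i)}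

/-- A shift space is sofic if it is presented by a finite labeled graph. -/
def IsSofic {A : Type*} [TopologicalSpace A] (X : Subshift A ℤ) : Prop :=
  ∃ (V E : Type) (_ : Finite V) (_ : Finite E) (G : LabeledGraph V E A), X.carrier = G.presented

/-- The shift map `σ_X` of a shift space `X`, `(σ_X x) i = x (i + 1)`, as a homeomorphism. -/
def shiftHomeo {A : Type*} [TopologicalSpace A] (X : Subshift A ℤ) : X.carrier ≃ₜ X.carrier where
  toFun := (X.mapsTo 1).restrict
  invFun := (X.mapsTo (-1)).restrict
  left_inv x := Subtype.ext <| funext fun i => by simp [Set.MapsTo.restrict, Subtype.map]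
  right_inv x := Subtype.ext <| funext fun i => by simp [Set.MapsTo.restrict, Subtype.map]
  continuous_toFun := (continuous_shift (A := A) (1 : ℤ)).restrict (X.mapsTo 1)
  continuous_invFun := (continuous_shift (A := A) (-1 : ℤ)).restrict (X.mapsTo (-1))

theorem shiftHomeo_apply {A : Type*} [TopologicalSpace A] (X : Subshift A ℤ) (x : X.carrier)
    (i : ℤ) : (shiftHomeo X x).1 i = x.1 (i + 1) :=
  congrArg x.1 (add_comm 1 i)

end FlipSystem

/-! Recode `x` as the sequence of pairs `(x i, (φ x) (-i))`. The flip then becomes reversal of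
coordinates composed with the swap of each pair. By compactness `φ` is given by a finite window, so
the recoded points are exactly the sequences accepted by a finite automaton
(`IsSofic.exists_automaton`).

A recoded point counted by `p_{m,n}`, for `n` equal to `0` or `1`, is a periodic sequence with a
reflection symmetry. It is determined by half a period `w` together with the swap-invariant letters
on the axes of reflection: one for odd `m` and `n = 0`, two for even `m` and `n = 0`, none for even
`m` and `n = 1`. For fixed axis letters the admissible `w` form a regular language
(`isRegular_mirrorLanguage`), because a prefix of `w` matters only through the state relations of
the prefix and of its mirror image. Regular languages have rational generating functions, and the
series is a finite combination of these, with `t ^ 2` for each letter of `w`. -/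

/-! ### Rational power series. -/

namespace PowerSeries

/-- A power series is rational if it is a quotient of polynomials whose denominator does not
vanish at `0`. -/
def IsRational (f : PowerSeries ℚ) : Prop :=
  ∃ P Q : Polynomial ℚ, Q.coeff 0 ≠ 0 ∧ (Q : PowerSeries ℚ) * f = (P : PowerSeries ℚ)

theorem isRational_coe (P : Polynomial ℚ) : IsRational (P : PowerSeries ℚ) :=
  ⟨P, 1, by simp, by simp⟩

theorem IsRational.add {f g : PowerSeries ℚ} (hf : IsRational f) (hg : IsRational g) :
    IsRational (f + g) := by
  obtain ⟨P, Q, hQ, h⟩ := hf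
  obtain ⟨P', Q', hQ', h'⟩ := hg
  refine ⟨P * Q' + P' * Q, Q * Q', by simp [Polynomial.mul_coeff_zero, hQ, hQ'], ?_⟩
  push_cast
  rw [← h, ← h']
  ring

theorem IsRational.mul {f g : PowerSeries ℚ} (hf : IsRational f) (hg : IsRational g) :
    IsRational (f * g) := by
  obtain ⟨P, Q, hQ, h⟩ := hf
  obtain ⟨P', Q', hQ', h'⟩ := hg
  refine ⟨P * P', Q * Q', by simp [Polynomial.mul_coeff_zero, hQ, hQ'], ?_⟩
  push_cast
  rw [← h, ← h']
  ring

theorem IsRational.sum {ι : Type*} (s : Finset ι) {f : ι → PowerSeries ℚ}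
    (hf : ∀ i ∈ s, IsRational (f i)) : IsRational (∑ i ∈ s, f i) := by
  classical
  induction s using Finset.induction_on with
  | empty => simpa using isRational_coe 0
  | insert a s ha ih =>
    rw [Finset.sum_insert ha]
    exact (hf a (by simp)).add (ih fun i hi => hf i (by simp [hi]))

/-- The components of the solution of a linear system `F = p + t N F` with polynomial
coefficients are rational. -/
theorem isRational_of_linear_system {σ : Type*} [Fintype σ] [DecidableEq σ]
    (N : Matrix σ σ (Polynomial ℚ)) (p : σ → Polynomial ℚ) (F : σ → PowerSeries ℚ)
    (hF : ∀ s, F s = (p s : PowerSeries ℚ) + X * ∑ s', (N s s' : PowerSeries ℚ) * F s') (s : σ) :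
    IsRational (F s) := by
  let φ : Polynomial ℚ →+* PowerSeries ℚ := Polynomial.coeToPowerSeries.ringHom
  have hφ : ∀ q, φ q = (q : PowerSeries ℚ) := fun q => rfl
  let K : Matrix σ σ (Polynomial ℚ) := 1 - (Polynomial.X : Polynomial ℚ) • N
  have hK : (φ.mapMatrix K).mulVec F = fun s => φ (p s) := by
    funext s
    have h1 : φ.mapMatrix K = 1 - (X : PowerSeries ℚ) • φ.mapMatrix N := by
      ext1 i j
      simp only [K, RingHom.mapMatrix_apply, Matrix.map_apply, Matrix.sub_apply,
        Matrix.smul_apply, smul_eq_mul, map_sub, Matrix.one_apply, hφ]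
      split_ifs <;> simp
    rw [h1, Matrix.sub_mulVec, Matrix.one_mulVec, Matrix.smul_mulVec]
    simp only [Pi.sub_apply, Pi.smul_apply, smul_eq_mul, Matrix.mulVec, dotProduct,
      RingHom.mapMatrix_apply, Matrix.map_apply, hφ]
    exact sub_eq_of_eq_add (hF s)
  -- Cramer's rule: multiplying `K F = p` by the adjugate leaves `det K` as a common denominator. It
  -- has constant term 1, since `K` is the identity at `t = 0`.
  have hadj : (K.det : PowerSeries ℚ) • F =
      (φ.mapMatrix K.adjugate).mulVec (fun s => φ (p s)) := by
    rw [← hK, Matrix.mulVec_mulVec, ← map_mul, Matrix.adjugate_mul]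
    have : φ.mapMatrix (K.det • (1 : Matrix σ σ (Polynomial ℚ))) = φ K.det • 1 := by
      ext1 i j
      simp only [RingHom.mapMatrix_apply, Matrix.map_apply, Matrix.smul_apply, smul_eq_mul,
        map_mul, Matrix.one_apply]
      split_ifs <;> simp
    rw [this, Matrix.smul_mulVec, Matrix.one_mulVec, hφ]
  refine ⟨∑ s', K.adjugate s s' * p s', K.det, ?_, ?_⟩
  · have : Polynomial.constantCoeff K.det = 1 := by
      rw [RingHom.map_det]
      have : (Polynomial.constantCoeff (R := ℚ)).mapMatrix K = 1 := by
        ext1 i j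
        simp only [K, RingHom.mapMatrix_apply, Matrix.map_apply, Matrix.sub_apply,
          Matrix.smul_apply, smul_eq_mul, map_sub, map_mul, Matrix.one_apply]
        split_ifs <;> simp
      rw [this, Matrix.det_one]
    rw [Polynomial.constantCoeff_apply] at this
    simp [this]
  · have := congrFun hadj s
    simp only [Pi.smul_apply, smul_eq_mul, Matrix.mulVec, dotProduct, RingHom.mapMatrix_apply,
      Matrix.map_apply] at this
    rw [this, ← hφ, map_sum]
    simp

/-- The power series `∑ a k t ^ (2 k)`. -/
noncomputable def evenSeries (a : ℕ → ℚ) : PowerSeries ℚ :=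
  mk fun m => if Even m then a (m / 2) else 0

theorem evenSeries_sum {ι : Type*} (s : Finset ι) (a : ι → ℕ → ℚ) :
    evenSeries (fun k => ∑ i ∈ s, a i k) = ∑ i ∈ s, evenSeries (a i) := by
  ext m
  rw [map_sum]
  simp only [evenSeries, coeff_mk]
  split_ifs <;> simp

theorem evenSeries_eq (a : ℕ → ℚ) :
    evenSeries a = C (a 0) + X ^ 2 * evenSeries (fun k => a (k + 1)) := by
  ext m
  rcases m with _ | _ | m
  · simp [evenSeries]
  · simp [evenSeries, coeff_X_pow_mul']
  · rw [map_add, add_assoc m 1 1, coeff_X_pow_mul]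
    simp [evenSeries, Nat.even_add]

/-- A power series with geometrically bounded coefficients is the quotient, near `0`, of
the polynomials that represent it. -/
theorem hasSum_of_mul_eq_coe {f : PowerSeries ℚ} {P Q : Polynomial ℚ} (hQ : Q.coeff 0 ≠ 0)
    (h : (Q : PowerSeries ℚ) * f = P) (c : ℝ) (hc : 0 < c) (hf : ∀ m, |((coeff m f : ℚ) : ℝ)| ≤ c ^ m) :
    ∃ r : ℝ, 0 < r ∧ ∀ t : ℂ, ‖t‖ < r → Polynomial.aeval t Q ≠ 0 ∧
      HasSum (fun m : ℕ => ((coeff m f : ℚ) : ℂ) * t ^ m)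
        (Polynomial.aeval t P / Polynomial.aeval t Q) := by
  have hcont : Continuous fun t : ℂ => Polynomial.aeval t Q := Q.continuous_aeval
  have h0 : Polynomial.aeval (0 : ℂ) Q ≠ 0 := by
    rw [← Polynomial.coeff_zero_eq_aeval_zero']
    simpa using hQ
  obtain ⟨δ, hδ, hball⟩ := Metric.eventually_nhds_iff.1 (hcont.continuousAt.eventually_ne h0)
  -- Within `δ` the denominator does not vanish; within `c⁻¹` the series is dominated by a geometric
  -- one.
  refine ⟨min δ c⁻¹, lt_min hδ (inv_pos.2 hc), fun t ht => ?_⟩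
  have hQt : Polynomial.aeval t Q ≠ 0 := hball (by simpa using ht.trans_le (min_le_left _ _))
  refine ⟨hQt, ?_⟩
  have hct : c * ‖t‖ < 1 := by
    simpa [hc.ne'] using mul_lt_mul_of_pos_left (ht.trans_le (min_le_right _ _)) hc
  have hsumf : Summable fun m : ℕ => ‖((coeff m f : ℚ) : ℂ) * t ^ m‖ := by
    refine Summable.of_nonneg_of_le (fun _ => norm_nonneg _) (fun m => ?_)
      (summable_geometric_of_lt_one (by positivity) hct)
    rw [norm_mul, norm_pow, mul_pow]
    gcongr
    have := hf m
    rw [show (((coeff m f : ℚ) : ℂ)) = (((coeff m f : ℚ) : ℝ) : ℂ) by push_cast; rfl,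
      Complex.norm_real]
    exact this
  have hpoly : ∀ R : Polynomial ℚ, HasSum (fun m : ℕ => ((R.coeff m : ℚ) : ℂ) * t ^ m)
      (Polynomial.aeval t R) := by
    intro R
    rw [Polynomial.aeval_eq_sum_range]
    simp only [Algebra.smul_def, eq_ratCast]
    apply hasSum_sum_of_ne_finset_zero
    intro m hm
    rw [Polynomial.coeff_eq_zero_of_natDegree_lt (by simpa using hm)]
    simp
  have hsumQ : Summable fun m : ℕ => ‖((Q.coeff m : ℚ) : ℂ) * t ^ m‖ := by
    apply summable_of_ne_finset_zero (s := Finset.range (Q.natDegree + 1))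
    intro m hm
    rw [Polynomial.coeff_eq_zero_of_natDegree_lt (by simpa using hm)]
    simp
  have hprod := tsum_mul_tsum_eq_tsum_sum_antidiagonal_of_summable_norm hsumQ hsumf
  have hcoef : ∀ m, ∑ kl ∈ Finset.HasAntidiagonal.antidiagonal m,
      ((Q.coeff kl.1 : ℚ) : ℂ) * t ^ kl.1 * (((coeff kl.2 f : ℚ) : ℂ) * t ^ kl.2) =
      ((P.coeff m : ℚ) : ℂ) * t ^ m := by
    intro m
    have := congrArg (coeff m) h
    rw [coeff_mul, Polynomial.coeff_coe] at this
    rw [← this, Rat.cast_sum, Finset.sum_mul]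
    refine Finset.sum_congr rfl fun kl hkl => ?_
    rw [← Finset.HasAntidiagonal.mem_antidiagonal.1 hkl, Polynomial.coeff_coe]
    push_cast
    ring
  simp only [hcoef] at hprod
  rw [(hpoly P).tsum_eq, (hpoly Q).tsum_eq] at hprod
  rw [← hprod, mul_div_cancel_left₀ _ hQt]
  exact hsumf.of_norm.hasSum

end PowerSeries

/-! ### Generating functions of regular languages. -/

/-- The number of the words of length `k` in a language. -/
noncomputable def Language.wordCount {B : Type*} (L : Language B) (k : ℕ) : ℕ :=
  {w | w ∈ L ∧ w.length = k}.ncard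

namespace Language

theorem wordCount_succ {B : Type*} [Fintype B] (L : Language B) (k : ℕ) :
    L.wordCount (k + 1) = ∑ b, wordCount {w | b :: w ∈ L} k := by
  classical
  have h : {w | w ∈ L ∧ w.length = k + 1} =
      ⋃ b : B, List.cons b '' {w | b :: w ∈ L ∧ w.length = k} := by
    ext w
    cases w with
    | nil => simp
    | cons b w => simp
  rw [wordCount, h, Set.ncard_iUnion_of_finite, finsum_eq_sum_of_fintype]
  · exact Finset.sum_congr rfl fun b _ => Set.ncard_image_of_injective _ (List.cons_injective)
  · intro b
    exact ((List.finite_length_eq B k).subset fun w hw => hw.2).image _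
  · intro b b' hbb'
    rw [Function.onFun, Set.disjoint_left]
    rintro _ ⟨w, _, rfl⟩ ⟨w', _, h⟩
    exact hbb' (by simpa using h.symm : b = b' ∧ _).1

theorem wordCount_zero {B : Type*} (L : Language B) [Decidable ([] ∈ L)] :
    L.wordCount 0 = if [] ∈ L then 1 else 0 := by
  have h : {w | w ∈ L ∧ w.length = 0} = if [] ∈ L then {[]} else ∅ := by
    ext w
    split_ifs with hL <;> cases w <;> simp [hL]
  rw [wordCount, h]
  split_ifs <;> simp

/-- The generating function of a regular language is rational. -/
theorem IsRegular.isRational {B : Type*} [Finite B] {L : Language B} (hL : L.IsRegular) :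
    (PowerSeries.evenSeries fun k => (L.wordCount k : ℚ)).IsRational := by
  classical
  obtain ⟨σ, _, M, rfl⟩ := hL
  cases nonempty_fintype B
  -- Transfer matrix of the DFA, one unknown per start state. Each letter weighs `t ^ 2`: one factor
  -- `t` is built into the linear system, the other is in the matrix entries.
  refine PowerSeries.isRational_of_linear_system
    (fun s s' => ∑ b : B, if M.step s b = s' then Polynomial.X else 0)
    (fun s => if s ∈ M.accept then 1 else 0)
    (fun s => PowerSeries.evenSeries fun k => ((M.acceptsFrom s).wordCount k : ℚ)) ?_ M.start
  intro s
  have hstep : ∀ b, {w | b :: w ∈ M.acceptsFrom s} = M.acceptsFrom (M.step s b) := fun b => rfl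
  rw [PowerSeries.evenSeries_eq]
  congr 1
  · rw [wordCount_zero]
    simp only [DFA.mem_acceptsFrom, DFA.evalFrom_nil]
    split_ifs <;> simp
  · simp only [wordCount_succ, hstep, Nat.cast_sum]
    rw [PowerSeries.evenSeries_sum, pow_two, mul_assoc]
    congr 1
    simp only [← Polynomial.coeToPowerSeries.ringHom_apply, map_sum, Finset.sum_mul]
    rw [Finset.sum_comm, Finset.mul_sum]
    refine Finset.sum_congr rfl fun b _ => ?_
    rw [Finset.sum_eq_single (M.step s b)]
    · simp
    · intro s' _ hs'
      simp [hs'.symm]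
    · simp

end Language

/-! ### Words invariant under twisted reversal. -/

namespace List

/-- The reversal of a word, with its letters replaced by their images under `τ`. -/
def mirror {B : Type*} (τ : B → B) (w : List B) : List B :=
  (w.map τ).reverse

variable {B : Type*} {τ : B → B}

theorem length_mirror (τ : B → B) (w : List B) : (w.mirror τ).length = w.length := by
  simp [mirror]

theorem mirror_append (τ : B → B) (v w : List B) :
    (v ++ w).mirror τ = w.mirror τ ++ v.mirror τ := by
  simp [mirror]

theorem mirror_mirror (hτ : Function.Involutive τ) (w : List B) : (w.mirror τ).mirror τ = w := by
  simp [mirror, hτ.comp_self]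

/-- A word of even length is invariant under `mirror` if and only if its second half is the
mirror image of its first half. -/
theorem ncard_mirror_eq_self_even (hτ : Function.Involutive τ) (P : List B → Prop) (k : ℕ) :
    {v : List B | v.mirror τ = v ∧ v.length = 2 * k ∧ P v}.ncard =
      {w : List B | P (w ++ w.mirror τ) ∧ w.length = k}.ncard := by
  have hinj : Set.InjOn (fun w : List B => w ++ w.mirror τ)
      {w : List B | P (w ++ w.mirror τ) ∧ w.length = k} := fun w hw w' hw' h =>
    (append_inj h (hw.2.trans hw'.2.symm)).1
  rw [← hinj.ncard_image]
  · congr 1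
    ext v
    constructor
    · rintro ⟨hv, hl, hP⟩
      have h : (v.drop k).mirror τ ++ (v.take k).mirror τ = v.take k ++ v.drop k := by
        rw [← mirror_append, take_append_drop, hv]
      have h2 := (append_inj h (by rw [length_mirror, length_drop, length_take]; omega)).2
      refine ⟨v.take k, ⟨?_, by rw [length_take]; omega⟩, ?_⟩
      · rwa [h2, take_append_drop]
      · simp only [h2, take_append_drop]
    · rintro ⟨w, ⟨hP, hl⟩, rfl⟩
      refine ⟨?_, ?_, hP⟩
      · simp only [mirror_append, mirror_mirror hτ]
      · simp only [length_append, length_mirror]; omega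

/-- A word of odd length is invariant under `mirror` if and only if its letter in the middle is
fixed and its second half is the mirror image of its first half. -/
theorem ncard_mirror_eq_self_odd [Finite B] [Fintype {c : B // τ c = c}]
    (hτ : Function.Involutive τ)
    (P : List B → Prop) (k : ℕ) :
    {v : List B | v.mirror τ = v ∧ v.length = 2 * k + 1 ∧ P v}.ncard =
      ∑ c : {c : B // τ c = c},
        {w : List B | P (w ++ [c.1] ++ w.mirror τ) ∧ w.length = k}.ncard := by
  have h : {v : List B | v.mirror τ = v ∧ v.length = 2 * k + 1 ∧ P v} =
      ⋃ c : {c : B // τ c = c}, (fun w : List B => w ++ [c.1] ++ w.mirror τ) ''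
        {w | P (w ++ [c.1] ++ w.mirror τ) ∧ w.length = k} := by
    ext v
    simp only [Set.mem_iUnion]
    constructor
    · rintro ⟨hv, hl, hP⟩
      obtain ⟨c, u, hu⟩ : ∃ c u, v.drop k = c :: u := by
        cases hd : v.drop k with
        | nil => have := congrArg length hd; simp at this; omega
        | cons c u => exact ⟨c, u, rfl⟩
      have hvw : v = v.take k ++ [c] ++ u := by
        conv_lhs => rw [← take_append_drop k v, hu]
        simp
      generalize hw : v.take k = w at hvw
      have hwl : w.length = k := by rw [← hw, length_take]; omega
      have hul : u.length = k := by
        have := congrArg length hvw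
        simp only [length_append, length_singleton] at this
        omega
      subst hvw
      rw [mirror_append, mirror_append, ← append_assoc] at hv
      obtain ⟨h1, h2⟩ := append_inj hv (by simp [length_mirror, hwl, hul])
      have h3 := (append_inj h1 (by simp [length_mirror, hwl, hul])).2
      refine ⟨⟨c, by simpa [mirror] using h3⟩, w, ⟨by rwa [h2], hwl⟩, ?_⟩
      simp only [h2]
    · rintro ⟨⟨c, hc⟩, w, ⟨hP, hl⟩, rfl⟩
      refine ⟨?_, ?_, hP⟩
      · rw [mirror_append, mirror_append, mirror_mirror hτ]
        have : [c].mirror τ = [c] := by simpa [mirror] using hc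
        simp only [this, append_assoc]
      · simp only [length_append, length_mirror, length_singleton]; omega
  rw [h, Set.ncard_iUnion_of_finite, finsum_eq_sum_of_fintype]
  · refine Finset.sum_congr rfl fun c _ => Set.InjOn.ncard_image fun w hw w' hw' h => ?_
    simp only [append_assoc] at h
    exact (append_inj h (hw.2.trans hw'.2.symm)).1
  · intro c
    apply Set.Finite.image
    exact (List.finite_length_eq B k).subset fun w hw => hw.2
  · intro c c' hcc'
    rw [Function.onFun, Set.disjoint_left]
    rintro _ ⟨w, ⟨_, hw⟩, rfl⟩ ⟨w', ⟨_, hw'⟩, h⟩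
    simp only [append_assoc] at h
    exact hcc' (Subtype.ext (head_eq_of_cons_eq (append_inj h (hw'.trans hw.symm)).2).symm)

end List

/-! ### Automata as relations, and the regularity of half-words. -/

namespace SymbolicDynamics

variable {B S : Type*}

/-- The relation between the endpoints of the paths that read a given word in an automaton with
transition relation `R`. -/
def pathRel (R : S → B → S → Prop) : List B → S → S → Prop
  | [] => Eq
  | b :: w => Relation.Comp (fun s s' => R s b s') (pathRel R w)

theorem pathRel_append (R : S → B → S → Prop) (u v : List B) :
    pathRel R (u ++ v) = Relation.Comp (pathRel R u) (pathRel R v) := by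
  induction u with
  | nil => exact Relation.eq_comp.symm
  | cons b u ih =>
    rw [List.cons_append, pathRel, ih, pathRel, Relation.comp_assoc]

theorem pathRel_ofFn (R : S → B → S → Prop) {n : ℕ} (f : Fin n → B) (s t : S) :
    pathRel R (List.ofFn f) s t ↔
      ∃ p : ℕ → S, p 0 = s ∧ p n = t ∧ ∀ i : Fin n, R (p i) (f i) (p (i + 1)) := by
  induction n generalizing s with
  | zero =>
    simp only [List.ofFn_zero, pathRel]
    constructor
    · rintro rfl
      exact ⟨fun _ => s, rfl, rfl, fun i => i.elim0⟩
    · rintro ⟨p, rfl, rfl, _⟩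
      rfl
  | succ n ih =>
    rw [List.ofFn_succ, pathRel]
    constructor
    · rintro ⟨s', hs', h⟩
      obtain ⟨p, h0, hn, hp⟩ := (ih _ _).1 h
      refine ⟨fun i => Nat.casesOn i s p, rfl, hn, fun i => ?_⟩
      refine Fin.cases ?_ (fun j => ?_) i
      · simpa [h0] using hs'
      · simpa using hp j
    · rintro ⟨p, rfl, rfl, hp⟩
      exact ⟨p 1, by simpa using hp 0,
        (ih _ _).2 ⟨fun i => p (i + 1), rfl, rfl, fun i => by simpa using hp i.succ⟩⟩

/-- The bi-infinite sequence `y` labels a bi-infinite path of the automaton. -/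
def IsAccepted (R : S → B → S → Prop) (y : ℤ → B) : Prop :=
  ∃ z : ℤ → S, ∀ i, R (z i) (y i) (z (i + 1))

/-- The bi-infinite repetition of the word `u` labels a bi-infinite path of the automaton. -/
def IsCyclicallyAccepted (R : S → B → S → Prop) (u : List B) : Prop :=
  ∃ ζ : ℤ → S, ∀ i, pathRel R u (ζ i) (ζ (i + 1))

/-- Only the labels are periodic; the path need not close up after `m` steps. Sampling its states at
multiples of `m` therefore gives a bi-infinite orbit of one relation on states. -/
theorem isAccepted_iff_of_periodic (R : S → B → S → Prop) {m : ℕ} (hm : 1 ≤ m) {y : ℤ → B}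
    (hy : Function.Periodic y m) :
    IsAccepted R y ↔ IsCyclicallyAccepted R (List.ofFn fun i : Fin m => y i) := by
  have hm0 : (0 : ℤ) < m := by exact_mod_cast hm
  simp only [IsCyclicallyAccepted, pathRel_ofFn]
  constructor
  · rintro ⟨z, hz⟩
    refine ⟨fun i => z (i * m), fun i => ⟨fun j => z (i * m + j), by simp, by simp only [add_mul, one_mul],
      fun j => ?_⟩⟩
    · have := hz (i * m + j)
      have hyy : y (i * m + j) = y j := by
        rw [add_comm]; exact_mod_cast hy.int_mul i j
      rw [hyy] at this
      simpa [add_assoc] using this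
  · rintro ⟨ζ, hζ⟩
    choose p h0 hm' hp using hζ
    -- The finite paths over the successive blocks are glued; consecutive ones share an endpoint.
    refine ⟨fun i => p (i / m) (i % m).toNat, fun i => ?_⟩
    have hr0 := Int.emod_nonneg i hm0.ne'
    have hr1 := Int.emod_lt_of_pos i hm0
    have hdiv := Int.emod_add_mul_ediv i m
    set q := i / m
    obtain ⟨r, hr⟩ := Int.eq_ofNat_of_zero_le hr0
    have hrm : r < m := by omega
    have hyi : y i = y r := by
      rw [← hdiv, hr, mul_comm]; exact_mod_cast hy.int_mul q r
    have hstep := hp q ⟨r, hrm⟩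
    simp only [← hyi] at hstep
    have hnext : p ((i + 1) / m) ((i + 1) % m).toNat = p q (r + 1) := by
      rcases Nat.lt_or_ge (r + 1) m with h | h
      · have e : i + 1 = ((r + 1 : ℕ) : ℤ) + m * q := by push_cast; omega
        have h' : ((r + 1 : ℕ) : ℤ) < m := by exact_mod_cast h
        rw [e, Int.add_mul_ediv_left _ _ hm0.ne', Int.add_mul_emod_self_left,
          Int.ediv_eq_zero_of_lt (by positivity) h', Int.emod_eq_of_lt (by positivity) h', zero_add,
          Int.toNat_natCast]
      · have e : i + 1 = m * (q + 1) := by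
          have : (r : ℤ) + 1 = m := by omega
          linarith
        have hrm' : r + 1 = m := by omega
        rw [e, Int.mul_ediv_cancel_left _ hm0.ne', Int.mul_emod_right, hrm', hm']
        exact h0 _
    simp only [hnext, hr]
    exact hstep

/-- The words `w` for which the bi-infinite repetition of `a w c w'` is accepted by an
automaton, where `w'` is the mirror image of `w`. -/
def mirrorLanguage (R : S → B → S → Prop) (τ : B → B) (a c : List B) : Language B :=
  {w : List B | IsCyclicallyAccepted R (a ++ (w ++ c ++ w.mirror τ))}

theorem isRegular_mirrorLanguage [Finite S] (R : S → B → S → Prop) (τ : B → B) (a c : List B) :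
    (mirrorLanguage R τ a c).IsRegular := by
  apply Language.IsRegular.of_finite_range_leftQuotient
  -- The left quotient by `x` depends only on the relations of `x` and of its mirror image, and
  -- there are finitely many pairs of relations on a finite set. This is the Myhill–Nerode
  -- criterion.
  let g : (S → S → Prop) × (S → S → Prop) → Language B := fun P =>
    {w : List B | ∃ ζ : ℤ → S, ∀ i, Relation.Comp (pathRel R a)
      (Relation.Comp P.1 (Relation.Comp (pathRel R (w ++ c ++ w.mirror τ)) P.2))
        (ζ i) (ζ (i + 1))}
  refine (Set.finite_range g).subset ?_
  rintro _ ⟨x, rfl⟩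
  refine ⟨(pathRel R x, pathRel R (x.mirror τ)), ?_⟩
  ext w
  simp only [← pathRel_append, g]
  change (∃ ζ : ℤ → S, ∀ i, pathRel R _ (ζ i) (ζ (i + 1))) ↔
    ∃ ζ : ℤ → S, ∀ i, pathRel R (a ++ ((x ++ w) ++ c ++ (x ++ w).mirror τ)) (ζ i) (ζ (i + 1))
  simp only [List.mirror_append, List.append_assoc]

end SymbolicDynamics

/-! ### Recoding a flip as a letterwise swapped reversal. -/

namespace FlipSystem

section Recoding

variable {A : Type*} [TopologicalSpace A] (X : Subshift A ℤ)

theorem shiftHomeo_zpow_apply (n : ℤ) (x : X.carrier) (i : ℤ) :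
    ((shiftHomeo X ^ n) x).1 i = x.1 (i + n) := by
  induction n using Int.induction_on generalizing i with
  | zero => simp
  | succ n ih =>
    have : (shiftHomeo X ^ ((n : ℤ) + 1)) x = shiftHomeo X ((shiftHomeo X ^ (n : ℤ)) x) := by
      rw [add_comm, zpow_add, zpow_one]; rfl
    rw [this, shiftHomeo_apply, ih]
    exact congrArg x.1 (by omega)
  | pred n ih =>
    have h : shiftHomeo X ((shiftHomeo X ^ (-(n : ℤ) - 1)) x) = (shiftHomeo X ^ (-(n : ℤ))) x := by
      have : shiftHomeo X ^ (-(n : ℤ)) = shiftHomeo X * shiftHomeo X ^ (-(n : ℤ) - 1) := by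
        rw [← zpow_one_add]
        congr 1; omega
      rw [this]; rfl
    have h' := shiftHomeo_apply X ((shiftHomeo X ^ (-(n : ℤ) - 1)) x) (i - 1)
    rw [h, ih, sub_add_cancel] at h'
    rw [← h']
    exact congrArg x.1 (by omega)

theorem shiftHomeo_pow_apply (n : ℕ) (x : X.carrier) (i : ℤ) :
    ((shiftHomeo X ^ n) x).1 i = x.1 (i + n) := by
  rw [← zpow_natCast, shiftHomeo_zpow_apply]

variable {X} {φ : X.carrier ≃ₜ X.carrier}

theorem IsFlip.apply_zpow (hφ : IsFlip (shiftHomeo X) φ) (n : ℤ) (x : X.carrier) :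
    φ ((shiftHomeo X ^ n) x) = (shiftHomeo X ^ (-n)) (φ x) := by
  have h : φ * shiftHomeo X * φ⁻¹ = (shiftHomeo X)⁻¹ := by
    ext1 y
    change φ (shiftHomeo X (φ.symm y)) = (shiftHomeo X).symm y
    rw [hφ.comm, φ.apply_symm_apply]
  have h2 : φ * shiftHomeo X ^ n = shiftHomeo X ^ (-n) * φ := by
    rw [zpow_neg, ← inv_zpow, ← h, conj_zpow, inv_mul_cancel_right]
  exact congrArg (fun g : X.carrier ≃ₜ X.carrier => g x) h2

/-- Reduces every coordinate of `φ x` to the coordinate 0 of the image of a shifted point, so that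
one window serves for all coordinates. -/
theorem IsFlip.apply_coord (hφ : IsFlip (shiftHomeo X) φ) (x : X.carrier) (i : ℤ) :
    (φ x).1 (-i) = (φ ((shiftHomeo X ^ i) x)).1 0 := by
  rw [hφ.apply_zpow, shiftHomeo_zpow_apply, zero_add]

/-- The recoding of the points of `X` under which a flip becomes the composition of the
reversal of coordinates with a one-block map. -/
def flipCode (φ : X.carrier ≃ₜ X.carrier) (x : X.carrier) : ℤ → A × A :=
  fun i => (x.1 i, (φ x).1 (-i))

theorem flipCode_injective (φ : X.carrier ≃ₜ X.carrier) : Function.Injective (flipCode φ) :=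
  fun _ _ h => Subtype.ext <| funext fun i => congrArg Prod.fst (congrFun h i)

theorem IsFlip.flipCode_flip (hφ : IsFlip (shiftHomeo X) φ) (x : X.carrier) (i : ℤ) :
    flipCode φ (φ x) i = (flipCode φ x (-i)).swap := by
  simp [flipCode, hφ.invol]

theorem IsFlip.flipCode_zpow (hφ : IsFlip (shiftHomeo X) φ) (n : ℤ) (x : X.carrier) (i : ℤ) :
    flipCode φ ((shiftHomeo X ^ n) x) i = flipCode φ x (i + n) := by
  simp only [flipCode, hφ.apply_zpow, shiftHomeo_zpow_apply]
  rw [neg_add]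

theorem IsFlip.mem_fixedSet_iff (hφ : IsFlip (shiftHomeo X) φ) (m : ℕ) (n : ℤ) (x : X.carrier) :
    x ∈ fixedSet (shiftHomeo X) φ m n ↔
      Function.Periodic (flipCode φ x) m ∧
        ∀ i, (flipCode φ x (-(i + n))).swap = flipCode φ x i := by
  refine and_congr ?_ ?_
  · rw [← (flipCode_injective φ).eq_iff, ← zpow_natCast, funext_iff]
    simp only [hφ.flipCode_zpow]
    rfl
  · rw [← (flipCode_injective φ).eq_iff, funext_iff]
    simp only [hφ.flipCode_zpow, hφ.flipCode_flip]

end Recoding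

/-! ### The recoded sofic shift has a finite automaton. -/

section Coding

variable {A : Type*} [Finite A] [TopologicalSpace A] [DiscreteTopology A]

/-- A continuous map from a closed set of sequences over a finite alphabet to a discrete space
depends only on finitely many coordinates. -/
theorem exists_window {K : Set (ℤ → A)} (hK : IsClosed K) (f : K → A) (hf : Continuous f) :
    ∃ N : ℕ, ∀ x x' : K, (∀ i : ℤ, |i| ≤ N → x.1 i = x'.1 i) → f x = f x' := by
  by_contra! hcon
  have : CompactSpace K := isCompact_iff_compactSpace.1 hK.isCompact
  -- If no window works, these nested compact sets of bad pairs are nonempty. A common element would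
  -- be a pair of equal points with different images.
  let t : ℕ → Set (K × K) := fun N =>
    {p | (∀ i : ℤ, |i| ≤ N → p.1.1 i = p.2.1 i) ∧ f p.1 ≠ f p.2}
  have hclosed : ∀ N, IsClosed (t N) := by
    intro N
    refine IsClosed.inter ?_ ?_
    · have : {p : K × K | ∀ i : ℤ, |i| ≤ N → p.1.1 i = p.2.1 i} =
          ⋂ (i : ℤ) (_ : |i| ≤ N), {p : K × K | p.1.1 i = p.2.1 i} := by
        ext p
        simp
      change IsClosed {p : K × K | ∀ i : ℤ, |i| ≤ N → p.1.1 i = p.2.1 i}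
      rw [this]
      refine isClosed_iInter fun i => isClosed_iInter fun _ => isClosed_eq ?_ ?_
      · exact (continuous_apply i).comp (continuous_subtype_val.comp continuous_fst)
      · exact (continuous_apply i).comp (continuous_subtype_val.comp continuous_snd)
    · have : Continuous fun p : K × K => (f p.1, f p.2) := by fun_prop
      exact (isClosed_discrete {q : A × A | q.1 ≠ q.2}).preimage this
  obtain ⟨p, hp⟩ := IsCompact.nonempty_iInter_of_sequence_nonempty_isCompact_isClosed t
    (fun N p hp => ⟨fun i hi => hp.1 i (hi.trans (by push_cast; linarith)), hp.2⟩)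
    (fun N => by
      obtain ⟨x, x', h, h'⟩ := hcon N
      exact ⟨(x, x'), h, h'⟩)
    (hclosed 0).isCompact hclosed
  rw [Set.mem_iInter] at hp
  refine (hp 0).2 (congrArg f (Subtype.ext (funext fun i => (hp i.natAbs).1 i ?_)))
  simp

/-- The recoded points of a sofic shift are the sequences that are accepted by a finite
automaton. -/
theorem IsSofic.exists_automaton {X : Subshift A ℤ} (hX : IsSofic X)
    {φ : X.carrier ≃ₜ X.carrier} (hφ : IsFlip (shiftHomeo X) φ) :
    ∃ (S : Type) (_ : Finite S) (R : S → A × A → S → Prop),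
      ∀ y, SymbolicDynamics.IsAccepted R y ↔ ∃ x, flipCode φ x = y := by
  obtain ⟨V, E, _, _, G, hG⟩ := hX
  obtain ⟨N, hN⟩ := exists_window X.isClosed (fun x => (φ x).1 0)
    ((continuous_apply 0).comp (continuous_subtype_val.comp φ.continuous))
  -- In the state at time `i`, slot `j` holds the edge at position `i + j - N`. The central edge
  -- gives the first letter, and the whole window determines the second. Adjacency of edges is
  -- imposed separately because overlap alone says nothing when `N = 0`.
  refine ⟨Fin (2 * N + 1) → E, inferInstance, fun s b s' =>
    (∀ j : Fin (2 * N), s' j.castSucc = s j.succ) ∧ G.target (s 0) = G.source (s' 0) ∧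
      b.1 = G.label (s ⟨N, by omega⟩) ∧
      ∃ x : X.carrier, (∀ j : Fin (2 * N + 1), x.1 (j - N) = G.label (s j)) ∧ b.2 = (φ x).1 0,
    fun y => ⟨?_, ?_⟩⟩
  · rintro ⟨z, hz⟩
    -- The overlaps make all the windows pieces of one edge sequence, namely that of the slots 0.
    have hz' : ∀ (j : ℕ) (h : j < 2 * N + 1) (i : ℤ), z i ⟨j, h⟩ = z (i + j) 0 := by
      intro j
      induction j with
      | zero => intro h i; simp
      | succ j ih =>
        intro h i
        have h1 := (hz i).1 ⟨j, by omega⟩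
        simp only [Fin.castSucc_mk, Fin.succ_mk] at h1
        rw [← h1, ih (by omega)]
        congr 1
        push_cast
        omega
    have hmem : (fun i => G.label (z (i + N) 0)) ∈ X.carrier := by
      rw [hG]
      refine ⟨fun i => z (i + N) 0, fun i => ?_, fun i => rfl⟩
      rw [(hz (i + N)).2.1]
      congr 2
      omega
    refine ⟨⟨_, hmem⟩, funext fun i => ?_⟩
    obtain ⟨-, -, h1, x, hx, h2⟩ := hz i
    refine Prod.ext ?_ ?_
    · rw [h1, hz']
      rfl
    · rw [h2]
      simp only [flipCode]
      rw [hφ.apply_coord]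
      refine hN _ _ fun k hk => ?_
      rw [abs_le] at hk
      obtain ⟨j, hj⟩ := Int.eq_ofNat_of_zero_le (show 0 ≤ k + N by omega)
      have hxk := hx ⟨j, by omega⟩
      rw [hz'] at hxk
      rw [shiftHomeo_zpow_apply]
      have e1 : k = (j : ℤ) - N := by omega
      rw [e1]
      refine Eq.trans ?_ hxk.symm
      simp only
      congr 2
      omega
  · rintro ⟨x, rfl⟩
    obtain ⟨e, he, hxe⟩ := hG.subset x.2
    refine ⟨fun i j => e (i + j - N), fun i => ⟨fun j => ?_, ?_, ?_, (shiftHomeo X ^ i) x,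
      fun j => ?_, ?_⟩⟩
    · simp only [Fin.val_castSucc, Fin.val_succ]
      congr 1
      push_cast
      omega
    · simp only [he]
      congr 2
      simp
      omega
    · simp [flipCode, hxe]
    · rw [shiftHomeo_zpow_apply, hxe]
      congr 2
      ring
    · exact hφ.apply_coord x i

end Coding

end FlipSystem

/-! ### Symmetric periodic sequences as words. -/

namespace SymbolicDynamics

variable {B S : Type*}

theorem exists_periodic_extension {m : ℕ} (hm : 1 ≤ m) (f : Fin m → B) :
    ∃ y : ℤ → B, Function.Periodic y m ∧ ∀ i : Fin m, y i = f i := by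
  have hm0 : (0 : ℤ) < m := by exact_mod_cast hm
  refine ⟨fun i => f ⟨(i % m).toNat, ?_⟩, fun i => by simp, fun i => ?_⟩
  · have := Int.emod_lt_of_pos i hm0
    omega
  · have h : ((i : ℕ) : ℤ) < m := by exact_mod_cast i.2
    simp [Int.emod_eq_of_lt (Int.natCast_nonneg _) h]

theorem periodic_ext {m : ℕ} (hm : 1 ≤ m) {y y' : ℤ → B} (hy : Function.Periodic y m)
    (hy' : Function.Periodic y' m) (h : ∀ i : Fin m, y i = y' i) : y = y' := by
  have hm0 : (0 : ℤ) < m := by exact_mod_cast hm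
  funext i
  obtain ⟨r, hr⟩ := Int.eq_ofNat_of_zero_le (Int.emod_nonneg i hm0.ne')
  have hrm : r < m := by
    have := Int.emod_lt_of_pos i hm0
    omega
  have hi : i = r + (i / m : ℤ) * m := by rw [← hr, mul_comm, Int.emod_add_mul_ediv]
  have e : ∀ u : ℤ → B, Function.Periodic u m → u i = u r := fun u hu => by
    rw [hi]; exact_mod_cast hu.int_mul (i / m) r
  rw [e y hy, e y' hy']
  exact h ⟨r, hrm⟩

theorem mirror_ofFn_eq_self_iff (τ : B → B) {m : ℕ} (f : Fin m → B) :
    (List.ofFn f).mirror τ = List.ofFn f ↔ ∀ i, τ (f i.rev) = f i := by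
  have h : (List.ofFn f).mirror τ = List.ofFn fun i => τ (f i.rev) := by
    refine List.ext_getElem (by simp [List.mirror]) fun i hi hi' => ?_
    simp only [List.mirror, List.map_ofFn, List.getElem_reverse, List.getElem_ofFn,
      List.length_ofFn, Function.comp_apply]
    congr 2
    ext
    simp only [Fin.val_rev]
    omega
  rw [h, List.ofFn_injective.eq_iff, funext_iff]

/-- The accepted sequences of period `m` that are invariant under the composition of the
reversal `i ↦ -(i + n)` of coordinates with the involution `τ` of the alphabet. -/
def symmetricSet (R : S → B → S → Prop) (τ : B → B) (m : ℕ) (n : ℤ) : Set (ℤ → B) :=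
  {y | IsAccepted R y ∧ Function.Periodic y m ∧ ∀ i, τ (y (-(i + n))) = y i}

theorem reflect_periodic {τ : B → B} {m : ℕ} {y : ℤ → B} (hy : Function.Periodic y m) (n : ℤ) :
    Function.Periodic (fun i => τ (y (-(i + n)))) m := fun i => by
  simp only
  rw [← hy (-(i + m + n))]
  congr 2
  ring

/-- Modulo `m`, `-(i + 1)` is `m - 1 - i`: the reflection reverses the block `0, …, m - 1`. -/
theorem ncard_symmetricSet_one (R : S → B → S → Prop) (τ : B → B) {m : ℕ} (hm : 1 ≤ m) :
    (symmetricSet R τ m 1).ncard =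
      {u : List B | u.mirror τ = u ∧ u.length = m ∧ IsCyclicallyAccepted R u}.ncard := by
  have hinj : Set.InjOn (fun y : ℤ → B => List.ofFn fun i : Fin m => y i)
      (symmetricSet R τ m 1) := fun y hy y' hy' h =>
    periodic_ext hm hy.2.1 hy'.2.1 (congrFun (List.ofFn_injective h))
  have key : ∀ y : ℤ → B, Function.Periodic y m → ((∀ i, τ (y (-(i + 1))) = y i) ↔
      (List.ofFn fun i : Fin m => y i).mirror τ = List.ofFn fun i : Fin m => y i) := by
    intro y hy
    have hrev : ∀ i : Fin m, y (-((i : ℤ) + 1)) = y (i.rev : ℕ) := fun i => by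
      rw [← hy (-((i : ℤ) + 1)), Fin.val_rev]
      congr 1
      omega
    rw [mirror_ofFn_eq_self_iff]
    simp only [← hrev]
    exact ⟨fun h i => h i, fun h i =>
      congrFun (periodic_ext hm (reflect_periodic hy 1) hy h) i⟩
  rw [← hinj.ncard_image]
  congr 1
  ext u
  constructor
  · rintro ⟨y, ⟨hacc, hy, hs⟩, rfl⟩
    exact ⟨(key y hy).1 hs, by simp, (isAccepted_iff_of_periodic R hm hy).1 hacc⟩
  · rintro ⟨hs, rfl, hacc⟩
    obtain ⟨y, hy, hyu⟩ := exists_periodic_extension hm u.get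
    have hu : (List.ofFn fun i : Fin u.length => y i) = u := by
      simp only [hyu, List.ofFn_get]
    refine ⟨y, ⟨(isAccepted_iff_of_periodic R hm hy).2 (by rwa [hu]), hy, ?_⟩, hu⟩
    exact (key y hy).2 (by rwa [hu])

/-- The reflection `i ↦ -i` fixes position 0, whose letter must be `τ`-invariant, and reverses the
block `1, …, k`. -/
theorem ncard_symmetricSet_zero [Finite B] (R : S → B → S → Prop) (τ : B → B)
    [Fintype {a : B // τ a = a}] (k : ℕ) :
    (symmetricSet R τ (k + 1) 0).ncard = ∑ a : {a : B // τ a = a},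
      {v : List B | v.mirror τ = v ∧ v.length = k ∧ IsCyclicallyAccepted R (a.1 :: v)}.ncard := by
  have hm : 1 ≤ k + 1 := by omega
  have hinj : Set.InjOn (fun y : ℤ → B => List.ofFn fun i : Fin (k + 1) => y i)
      (symmetricSet R τ (k + 1) 0) := fun y hy y' hy' h =>
    periodic_ext hm hy.2.1 hy'.2.1 (congrFun (List.ofFn_injective h))
  have key : ∀ y : ℤ → B, Function.Periodic y (k + 1 : ℕ) → ((∀ i, τ (y (-(i + 0))) = y i) ↔
      τ (y 0) = y 0 ∧ (List.ofFn fun i : Fin k => y (i.succ : ℕ)).mirror τ =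
        List.ofFn fun i : Fin k => y (i.succ : ℕ)) := by
    intro y hy
    have hrev : ∀ i : Fin k, y (-((i.succ : ℕ) + 0)) = y (i.rev.succ : ℕ) := fun i => by
      rw [← hy (-((i.succ : ℕ) + 0)), Fin.val_succ, Fin.val_succ, Fin.val_rev]
      congr 1
      omega
    rw [mirror_ofFn_eq_self_iff]
    simp only [← hrev]
    refine ⟨fun h => ⟨by simpa using h 0, fun i => h _⟩, fun h i =>
      congrFun (periodic_ext hm (reflect_periodic hy 0) hy fun i => ?_) i⟩
    refine Fin.cases ?_ (fun j => ?_) i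
    · simpa using h.1
    · exact h.2 j
  rw [← hinj.ncard_image]
  have hU : (fun y : ℤ → B => List.ofFn fun i : Fin (k + 1) => y i) '' symmetricSet R τ (k + 1) 0 =
      ⋃ a : {a : B // τ a = a}, List.cons a.1 ''
        {v : List B | v.mirror τ = v ∧ v.length = k ∧ IsCyclicallyAccepted R (a.1 :: v)} := by
    ext u
    rw [Set.mem_iUnion]
    constructor
    · rintro ⟨y, ⟨hacc, hy, hs⟩, rfl⟩
      have h := (isAccepted_iff_of_periodic R hm hy).1 hacc
      rw [List.ofFn_succ] at h
      exact ⟨⟨y 0, ((key y hy).1 hs).1⟩, _, ⟨((key y hy).1 hs).2, by simp, h⟩,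
        (List.ofFn_succ (f := fun i : Fin (k + 1) => y i)).symm⟩
    · rintro ⟨⟨a, ha⟩, v, ⟨hs, rfl, hacc⟩, rfl⟩
      obtain ⟨y, hy, hyu⟩ := exists_periodic_extension hm (Fin.cons a v.get : Fin (_ + 1) → B)
      have h0 : y 0 = a := by simpa using hyu 0
      have hv : (List.ofFn fun i : Fin v.length => y (i.succ : ℕ)) = v := by
        simp only [hyu, Fin.cons_succ, List.ofFn_get]
      have hu : (List.ofFn fun i : Fin (v.length + 1) => y i) = a :: v := by
        rw [List.ofFn_succ, hv]
        simp [h0]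
      refine ⟨y, ⟨(isAccepted_iff_of_periodic R hm hy).2 (by rwa [hu]), hy, ?_⟩, hu⟩
      exact (key y hy).2 (by rw [hv, h0]; exact ⟨ha, hs⟩)
  rw [hU, Set.ncard_iUnion_of_finite, finsum_eq_sum_of_fintype]
  · exact Finset.sum_congr rfl fun a _ => Set.ncard_image_of_injective _ List.cons_injective
  · intro a
    exact ((List.finite_length_eq B k).subset fun v hv => hv.2.1).image _
  · intro a a' haa'
    rw [Function.onFun, Set.disjoint_left]
    rintro _ ⟨w, _, rfl⟩ ⟨w', _, h⟩
    exact haa' (Subtype.ext (List.head_eq_of_cons_eq h).symm)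

theorem ncard_symmetricSet_odd_zero [Finite B] (R : S → B → S → Prop) {τ : B → B}
    (hτ : Function.Involutive τ) [Fintype {a : B // τ a = a}] (k : ℕ) :
    (symmetricSet R τ (2 * k + 1) 0).ncard =
      ∑ a : {a : B // τ a = a}, (mirrorLanguage R τ [a.1] []).wordCount k := by
  rw [ncard_symmetricSet_zero]
  refine Finset.sum_congr rfl fun a _ => ?_
  rw [List.ncard_mirror_eq_self_even hτ fun v => IsCyclicallyAccepted R (a.1 :: v)]
  simp only [Language.wordCount, mirrorLanguage, List.append_nil]
  rfl

/-- Modulo `2 * k + 2` there is a second fixed position, `k + 1`, which carries `c`. -/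
theorem ncard_symmetricSet_even_zero [Finite B] (R : S → B → S → Prop) {τ : B → B}
    (hτ : Function.Involutive τ) [Fintype {a : B // τ a = a}] (k : ℕ) :
    (symmetricSet R τ (2 * k + 2) 0).ncard = ∑ a : {a : B // τ a = a}, ∑ c : {c : B // τ c = c},
      (mirrorLanguage R τ [a.1] [c.1]).wordCount k := by
  rw [ncard_symmetricSet_zero]
  refine Finset.sum_congr rfl fun a _ => ?_
  rw [List.ncard_mirror_eq_self_odd hτ fun v => IsCyclicallyAccepted R (a.1 :: v)]
  rfl

theorem ncard_symmetricSet_even_one (R : S → B → S → Prop) {τ : B → B}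
    (hτ : Function.Involutive τ) (k : ℕ) :
    (symmetricSet R τ (2 * k + 2) 1).ncard = (mirrorLanguage R τ [] []).wordCount (k + 1) := by
  rw [ncard_symmetricSet_one R τ (by omega), show 2 * k + 2 = 2 * (k + 1) by ring,
    List.ncard_mirror_eq_self_even hτ]
  simp only [Language.wordCount, mirrorLanguage, List.append_nil, List.nil_append]
  rfl

end SymbolicDynamics

/-! ### Counting fixed points and assembling the series. -/

namespace FlipSystem

open PowerSeries SymbolicDynamics

theorem fixedCount_eq_ncard_symmetricSet {A : Type*} [TopologicalSpace A] {X : Subshift A ℤ}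
    {φ : X.carrier ≃ₜ X.carrier} (hφ : IsFlip (shiftHomeo X) φ) {S : Type*}
    {R : S → A × A → S → Prop} (hR : ∀ y, IsAccepted R y ↔ ∃ x, flipCode φ x = y)
    (m : ℕ) (n : ℤ) :
    fixedCount (shiftHomeo X) φ m n = (symmetricSet R Prod.swap m n).ncard := by
  rw [fixedCount, ← Set.ncard_image_of_injective _ (flipCode_injective φ)]
  congr 1
  ext y
  constructor
  · rintro ⟨x, hx, rfl⟩
    exact ⟨(hR _).2 ⟨x, rfl⟩, (hφ.mem_fixedSet_iff m n x).1 hx⟩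
  · rintro ⟨hy, hs⟩
    obtain ⟨x, rfl⟩ := (hR _).1 hy
    exact ⟨x, (hφ.mem_fixedSet_iff m n x).2 hs, rfl⟩

/-- One period determines the point. This gives finiteness, so that `ncard` is a true count and not
its default value 0, and also the bound needed for convergence. -/
theorem injOn_fixedSet {A : Type*} [TopologicalSpace A] {X : Subshift A ℤ}
    (φ : X.carrier ≃ₜ X.carrier) {m : ℕ} (hm : 1 ≤ m) (n : ℤ) :
    Set.InjOn (fun (x : X.carrier) (i : Fin m) => x.1 i) (fixedSet (shiftHomeo X) φ m n) := by
  have hper : ∀ x ∈ fixedSet (shiftHomeo X) φ m n, Function.Periodic x.1 (m : ℤ) := by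
    intro x hx i
    rw [← shiftHomeo_pow_apply, hx.1]
  exact fun x hx x' hx' h =>
    Subtype.ext (periodic_ext hm (hper x hx) (hper x' hx') (congrFun h))

theorem finite_fixedSet {A : Type*} [Finite A] [TopologicalSpace A] {X : Subshift A ℤ}
    (φ : X.carrier ≃ₜ X.carrier) {m : ℕ} (hm : 1 ≤ m) (n : ℤ) :
    (fixedSet (shiftHomeo X) φ m n).Finite :=
  Set.Finite.of_finite_image (Set.toFinite _) (injOn_fixedSet φ hm n)

theorem fixedCount_le {A : Type*} [Finite A] [TopologicalSpace A] {X : Subshift A ℤ}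
    (φ : X.carrier ≃ₜ X.carrier) {m : ℕ} (hm : 1 ≤ m) (n : ℤ) :
    fixedCount (shiftHomeo X) φ m n ≤ Nat.card A ^ m := by
  rw [fixedCount, ← (injOn_fixedSet φ hm n).ncard_image]
  refine (Set.ncard_le_card _).trans_eq ?_
  rw [Nat.card_fun, Nat.card_fin]

/-- The base exceeds the size of the alphabet by 1 so that it is positive even for an empty
alphabet. -/
theorem coeff_generatingFunction_le {A : Type*} [Finite A] [TopologicalSpace A] {X : Subshift A ℤ}
    (φ : X.carrier ≃ₜ X.carrier) (m : ℕ) :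
    |((coeff m (generatingFunction (shiftHomeo X) φ) : ℚ) : ℝ)| ≤ ((Nat.card A : ℝ) + 1) ^ m := by
  have h : ∀ n, 1 ≤ m → (fixedCount (shiftHomeo X) φ m n : ℝ) ≤ ((Nat.card A : ℝ) + 1) ^ m :=
    fun n hm => by
      refine le_trans (b := (Nat.card A : ℝ) ^ m) (by exact_mod_cast fixedCount_le φ hm n) ?_
      gcongr
      linarith
  rw [generatingFunction, coeff_mk]
  split_ifs with h0 h1
  · simp [h0]
  · simpa using h 0 (by omega)
  · push_cast
    rw [abs_of_nonneg (by positivity)]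
    linarith [h 0 (by omega), h 1 (by omega)]

/-- The counts for `n = 1` are word counts at `k + 1`, so the full language series has an extra
constant term `c 0`, which is subtracted. -/
theorem generatingFunction_eq {X : Type*} [TopologicalSpace X] (T F : X ≃ₜ X) (c : ℕ → ℚ)
    (hc : ∀ k, c (k + 1) = fixedCount T F (2 * k + 2) 1) :
    generatingFunction T F =
      PowerSeries.X * evenSeries (fun k => (fixedCount T F (2 * k + 1) 0 : ℚ)) +
        C (1 / 2) * (PowerSeries.X ^ 2 * evenSeries (fun k => (fixedCount T F (2 * k + 2) 0 : ℚ)) +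
          (evenSeries c + C (-c 0))) := by
  rw [evenSeries_eq c]
  simp only [hc]
  ext m
  rcases m with _ | m
  · simp [generatingFunction, evenSeries]
  rcases Nat.even_or_odd' m with ⟨k, rfl | rfl⟩
  · simp [generatingFunction, evenSeries, coeff_succ_X_mul, coeff_X_pow_mul']
    rcases k with _ | k
    · simp
    · have h : ¬Even (2 * (k + 1) - 1) := by simp [mul_add]
      simp [h]
  · simp [generatingFunction, evenSeries, coeff_succ_X_mul, coeff_X_pow_mul']
    rw [if_neg (by simp [parity_simps])]
    ring

theorem IsSofic.isRational_generatingFunction {A : Type*} [Finite A] [TopologicalSpace A]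
    [DiscreteTopology A] {X : Subshift A ℤ} (hX : IsSofic X) {φ : X.carrier ≃ₜ X.carrier}
    (hφ : IsFlip (shiftHomeo X) φ) : (generatingFunction (shiftHomeo X) φ).IsRational := by
  obtain ⟨S, _, R, hR⟩ := hX.exists_automaton hφ
  have hτ : Function.Involutive (Prod.swap : A × A → A × A) := Prod.swap_swap
  have := Fintype.ofFinite {a : A × A // a.swap = a}
  have hrat : ∀ a c, (evenSeries fun k =>
      ((mirrorLanguage R Prod.swap a c).wordCount k : ℚ)).IsRational := fun a c =>
    (isRegular_mirrorLanguage R Prod.swap a c).isRational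
  have hC : ∀ q : ℚ, (C q : PowerSeries ℚ).IsRational := fun q => by
    simpa using isRational_coe (Polynomial.C q)
  have hXr : (PowerSeries.X : PowerSeries ℚ).IsRational := by
    simpa using isRational_coe Polynomial.X
  rw [generatingFunction_eq _ _ (fun k => ((mirrorLanguage R Prod.swap [] []).wordCount k : ℚ))
    fun k => by rw [fixedCount_eq_ncard_symmetricSet hφ hR, ncard_symmetricSet_even_one R hτ]]
  simp only [fixedCount_eq_ncard_symmetricSet hφ hR, ncard_symmetricSet_odd_zero R hτ,
    ncard_symmetricSet_even_zero R hτ, Nat.cast_sum, evenSeries_sum]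
  refine (hXr.mul (IsRational.sum _ fun a _ => hrat _ _)).add ((hC _).mul (((pow_two
    (PowerSeries.X : PowerSeries ℚ) ▸ hXr.mul hXr).mul (IsRational.sum _ fun a _ =>
      IsRational.sum _ fun c _ => hrat _ _)).add ((hrat _ _).add (hC _))))

end FlipSystem

theorem mainTheorem2 {A : Type*} [Finite A] [TopologicalSpace A] [DiscreteTopology A]
    (X : SymbolicDynamics.FullShift.Subshift A ℤ) (hX : FlipSystem.IsSofic X)
    (φ : X.carrier ≃ₜ X.carrier) (hφ : FlipSystem.IsFlip (FlipSystem.shiftHomeo X) φ) :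
    (∀ (m : ℕ) (n : ℤ), 1 ≤ m → (FlipSystem.fixedSet (FlipSystem.shiftHomeo X) φ m n).Finite) ∧
    ∃ P Q : Polynomial ℚ, Q.coeff 0 ≠ 0 ∧
      (Q : PowerSeries ℚ) * FlipSystem.generatingFunction (FlipSystem.shiftHomeo X) φ
        = (P : PowerSeries ℚ) ∧
      ∃ r : ℝ, 0 < r ∧ ∀ t : ℂ, ‖t‖ < r →
        Polynomial.aeval t Q ≠ 0 ∧
        HasSum
          (fun m : ℕ => ((PowerSeries.coeff m
            (FlipSystem.generatingFunction (FlipSystem.shiftHomeo X) φ) : ℚ) : ℂ) * t ^ m)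
          (Polynomial.aeval t P / Polynomial.aeval t Q) := by
  refine ⟨fun m n hm => FlipSystem.finite_fixedSet φ hm n, ?_⟩
  obtain ⟨P, Q, hQ, h⟩ := hX.isRational_generatingFunction hφ
  exact ⟨P, Q, hQ, h, PowerSeries.hasSum_of_mul_eq_coe hQ h (Nat.card A + 1) (by positivity)
    (FlipSystem.coeff_generatingFunction_le φ)⟩
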